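/- Let $d=2$. A \emph{label model} specifies, for every $\phi\in\mathbb R^2$ with $\|\phi\|_2\le 1$ and $r\in[-1,1]$, a conditional law $\kappa(\cdot\mid\phi,r)$ on $[-1,1]$ with mean $r$ (measurable in $(\phi,r)$); given a distribution $\mathcal D$ on the unit ball of $\mathbb R^2$ and a parameter $\theta^*$ with $\|\theta^*\|_2\le 1$, the data $(\phi_i,y_i)$, $i=1,\dots,n$, are i.i.d. with $\phi_i\sim\mathcal D$ and $y_i\mid\phi_i\sim\kappa(\cdot\mid\phi_i,\langle\phi_i,\theta^*\rangle)$, so that $\mathbb E[y_i\mid\phi_i]=\langle\phi_i,\theta^*\rangle$ and $y_i\in[-1,1]$ (the noiseless model $y_i=\langle\phi_i,\theta^*\rangle$ is included). An estimator $\hat\theta_n$ is \emph{$\alpha$-locally private} if there is a measurable space $\mathcal Z$ such that entries $z_i\in\mathcal Z$ are generated successively as $z_i\sim\mathfrak Z_i(\cdot\mid z_1,\dots,z_{i-1},\phi_i,y_i)$, where the Markov kernels $\mathfrak Z_i$ satisfy $$\mathfrak Z_i(S\mid z_1,\dots,z_{i-1},\phi,y)\le e^{\alpha}\,\mathfrak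 Z_i(S\mid z_1,\dots,z_{i-1},\phi',y')$$ for all $z_1,\dots,z_{i-1}\in\mathcal Z$, all $\phi,\phi'$ in the unit ball, all $y,y'\in[-1,1]$ and all measurable $S\subseteq\mathcal Z$, and $\hat\theta_n\in\mathbb R^2$ is a (possibly randomized) function of $(z_1,\dots,z_n)$ only. Theorem. There are numerical constants $C>0$ and $c\in(0,1]$ and, for every $\alpha\in(0,1]$, a constant $C_\alpha>0$ depending only on $\alpha$, such that the following holds. For every $\alpha\in(0,1]$ and every $n\ge 1$ there are a probability distribution $\mathcal D_n$ on $\{x\in\mathbb R^2:\|x\|_2\le 1\}$, namely $$\phi=e_2\ \text{with probability}\ p_n=c\min\Big\{1,\frac{1}{(e^\alpha-1)\sqrt n}\Big\},\qquad \phi=e_1\ \text{with probability}\ 1-p_n,$$ and a parameter class $\Theta_n\subseteq\{\theta\in\mathbb R^2:\|\theta\|_2\le 1\}$ such that, for every label model and every $\alpha$-locally private estimator $\hat\theta_n$, $$\sup_{\theta^*\in\Theta_n}\mathbb E_{\theta^*,\mathcal D_n}\big[(\hat\theta_n-\theta^*)^\top\Lambda_{\mathcal D_n}(\hat\theta_n-\theta^*)\big]\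 \ge\ C\min\Big\{1,\frac{1}{(e^\alpha-1)\sqrt n}\Big\}$$ and $$\sup_{\theta^*\in\Theta_n}\mathbb E_{\theta^*,\mathcal D_n}\big[(\hat\theta_n-\theta^*)^\top\Lambda_{\mathcal D_n}(\hat\theta_n-\theta^*)\big]\ \ge\ \frac{C_\alpha}{(e^\alpha-1)\sqrt n},$$ where $\Lambda_{\mathcal D_n}=\mathbb E_{\phi\sim\mathcal D_n}[\phi\phi^\top]$. In particular, the bound $C/((e^\alpha-1)\sqrt n)$ with the numerical constant $C$ holds whenever $(e^\alpha-1)\sqrt n\ge 1$. -/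

import Mathlib

open MeasureTheory ProbabilityTheory

noncomputable section

namespace LDPRegression

/-- The feature / parameter space `ℝ²` with the Euclidean norm. -/
abbrev Vec := EuclideanSpace ℝ (Fin 2)

/-- The space of data entries `(φ, y)`: a feature vector and a label. -/
abbrev Data := Vec × ℝ

/-- The admissible data entries: `‖φ‖₂ ≤ 1` and `y ∈ [-1, 1]`. -/
def dataDomain : Set Data := {x | ‖x.1‖ ≤ 1 ∧ x.2 ∈ Set.Icc (-1 : ℝ) 1}

/-- A label model: the conditional law `law (φ, r)` of a label given the feature `φ` and the value
`r = ⟨φ, θ⟩` of the linear regression function at `φ`. Labels lie in `[-1, 1]` and have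
conditional mean `r`. -/
structure LabelModel where
  law : Kernel (Vec × ℝ) ℝ
  markov : IsMarkovKernel law
  bounded : ∀ (φ : Vec) (r : ℝ), ‖φ‖ ≤ 1 → |r| ≤ 1 → law (φ, r) (Set.Icc (-1 : ℝ) 1)ᶜ = 0
  mean : ∀ (φ : Vec) (r : ℝ), ‖φ‖ ≤ 1 → |r| ≤ 1 → ∫ y, y ∂(law (φ, r)) = r

/-- The regression value `⟨φ, θ⟩`, paired with the feature `φ`. -/
def withRegression (θ : Vec) (φ : Vec) : Vec × ℝ := (φ, inner ℝ φ θ)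

lemma measurable_withRegression (θ : Vec) : Measurable (withRegression θ) := by
  unfold withRegression
  fun_prop

/-- The law of one data entry `(φ, y)`: `φ ∼ D`, and `y` given `φ` has law
`L.law (φ, ⟨φ, θ⟩)`. -/
def dataLaw (D : Measure Vec) (L : LabelModel) (θ : Vec) : Measure Data :=
  D ⊗ₘ (L.law.comap (withRegression θ) (measurable_withRegression θ))

instance (D : Measure Vec) [IsProbabilityMeasure D] (L : LabelModel) (θ : Vec) :
    IsProbabilityMeasure (dataLaw D L θ) := by
  have := L.markov
  unfold dataLaw
  infer_instance

/-- A (sequentially interactive) `α`-locally private estimator of a parameter in `ℝ²` from `n` data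
entries, with storage space `Z`: the `i`-th stored entry `z i` is drawn from the privacy channel
`channel i` given the earlier entries `z 0, …, z (i - 1)` and the `i`-th data entry only, and the
estimate is computed (possibly with extra randomness) from the stored entries only. -/
structure PrivateEstimator (α : ℝ) (n : ℕ) (Z : Type*) [MeasurableSpace Z] where
  channel : ∀ i : Fin n, Kernel ((Fin i → Z) × Data) Z
  channel_markov : ∀ i, IsMarkovKernel (channel i)
  privacy : ∀ (i : Fin n) (z : Fin i → Z), ∀ x ∈ dataDomain, ∀ x' ∈ dataDomain,
    ∀ S : Set Z, MeasurableSet S →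
      channel i (z, x) S ≤ ENNReal.ofReal (Real.exp α) * channel i (z, x') S
  output : Kernel (Fin n → Z) Vec
  output_markov : IsMarkovKernel output

namespace PrivateEstimator

variable {α : ℝ} {n : ℕ} {Z : Type*} [MeasurableSpace Z]

/-- The law of the first `i` stored entries `z 0, …, z (i - 1)`, when the data entries are
independent with common law `P`: a fresh data entry `x ∼ P`, independent of the past, is fed into
the next channel, and the new stored entry is appended to the history. -/
def transcriptLaw (A : PrivateEstimator α n Z) (P : Measure Data) :
    ∀ i : ℕ, i ≤ n → Measure (Fin i → Z)
  | 0, _ => Measure.dirac (fun k => k.elim0)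
  | i + 1, h =>
    (((A.transcriptLaw P i (Nat.le_of_succ_le h)).prod P) ⊗ₘ A.channel ⟨i, h⟩).map
      (fun w => Fin.snoc (α := fun _ => Z) w.1.1 w.2)

lemma measurable_append (i : ℕ) :
    Measurable (fun w : ((Fin i → Z) × Data) × Z => Fin.snoc (α := fun _ => Z) w.1.1 w.2) := by
  refine measurable_pi_lambda _ fun k => ?_
  refine Fin.lastCases ?_ (fun j => ?_) k
  · simpa using measurable_snd
  · simp only [Fin.snoc_castSucc]
    exact (measurable_pi_apply j).comp (measurable_fst.comp measurable_fst)

lemma isProbabilityMeasure_transcriptLaw (A : PrivateEstimator α n Z) (P : Measure Data)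
    [IsProbabilityMeasure P] : ∀ (i : ℕ) (h : i ≤ n), IsProbabilityMeasure (A.transcriptLaw P i h)
  | 0, _ => by
    unfold transcriptLaw
    infer_instance
  | i + 1, h => by
    have h1 := A.isProbabilityMeasure_transcriptLaw P i (Nat.le_of_succ_le h)
    have h2 := A.channel_markov ⟨i, h⟩
    unfold transcriptLaw
    exact Measure.isProbabilityMeasure_map (measurable_append i).aemeasurable

/-- The law of the estimate computed from `n` independent data entries with common law `P`. -/
def estimateLaw (A : PrivateEstimator α n Z) (P : Measure Data) : Measure Vec :=
  (A.transcriptLaw P n le_rfl).bind A.output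

end PrivateEstimator

/-- The second-moment matrix `Λ_D = 𝔼_{φ ∼ D}[φ φᵀ]`. -/
def secondMoment (D : Measure Vec) : Matrix (Fin 2) (Fin 2) ℝ :=
  Matrix.of fun i j => ∫ φ, φ i * φ j ∂D

/-- The prediction error `(θ' - θ)ᵀ Λ_D (θ' - θ)`. -/
def predictionError (D : Measure Vec) (θ' θ : Vec) : ℝ :=
  (fun i => (θ' - θ) i) ⬝ᵥ (secondMoment D).mulVec (fun i => (θ' - θ) i)

/-- The mean-square error `𝔼[(θ' - θ)ᵀ Λ_D (θ' - θ)]` of the estimate `θ'`, as an extended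
nonnegative real, for the true parameter `θ`. -/
def meanSquareError {α : ℝ} {n : ℕ} {Z : Type*} [MeasurableSpace Z] (D : Measure Vec)
    (L : LabelModel) (A : PrivateEstimator α n Z) (θ : Vec) : ENNReal :=
  ∫⁻ θ', ENNReal.ofReal (predictionError D θ' θ) ∂(A.estimateLaw (dataLaw D L θ))

/-- The law of the random vector equal to `e₂` with probability `p` and to `e₁` with probability
`1 - p`. -/
def twoPointDesign (p : ℝ) : Measure Vec :=
  ENNReal.ofReal (1 - p) • Measure.dirac (EuclideanSpace.single 0 1) +
    ENNReal.ofReal p • Measure.dirac (EuclideanSpace.single 1 1)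

end LDPRegression

end

/-! Take `Θ = {e₂, -e₂}`. At `e₁` both parameters have regression value 0, so the label law there is
the same whatever the label model, and the data laws differ only on the event of probability `p`
that `φ = e₂`. Privacy makes the channel outputs on `e₁` and `e₂` comparable up to `exp α`, so given
any history the two laws of the next entry differ by a relative amount at most `δ = p (exp α - 1)
exp α` (`entryLaw_le`). Each entry thus costs a factor `1 + δ²` in χ², even with interaction
(`sq_lintegral_transcriptLaw_le`). For `p` of order `1 / ((exp α - 1) √n)`, `n δ²` stays bounded and
the sign of `θ 1` cannot be tested reliably. A wrong sign costs at least `p`, because `Λ = diag(1 -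
p, p)`; hence a risk of order `p` (`le_iSup_meanSquareError`). -/

open MeasureTheory ProbabilityTheory

namespace LDPRegression

/-! ### One-step χ² bound in dual form, without densities -/

/-- If `|μ - ν| ≤ δ ν` setwise then `(∫ f ∂μ)² ≤ (1 + δ²) ∫ f² ∂ν`, i.e. the `χ²`-divergence of `μ`
from `ν` is at most `δ²`. -/
lemma sq_integral_le_of_close {X : Type*} [MeasurableSpace X] (μ ν : Measure X)
    [IsProbabilityMeasure μ] [IsProbabilityMeasure ν] {δ : ℝ} (hδ : 0 ≤ δ)
    (h₁ : μ ≤ ν + ENNReal.ofReal δ • ν) (h₂ : ν ≤ μ + ENNReal.ofReal δ • ν)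
    {f : X → ℝ} (hf : Measurable f) (hf0 : ∀ x, 0 ≤ f x) (hf1 : ∀ x, f x ≤ 1) :
    (∫ x, f x ∂μ) ^ 2 ≤ (1 + δ ^ 2) * ∫ x, f x ^ 2 ∂ν := by
  have bdd : ∀ (ρ : Measure X) [IsFiniteMeasure ρ] (g : X → ℝ) (B : ℝ), Measurable g →
      (∀ x, |g x| ≤ B) → Integrable g ρ := fun ρ _ g B hg hB =>
    Integrable.of_bound hg.aestronglyMeasurable B (Filter.Eventually.of_forall hB)
  have hfin : IsFiniteMeasure (ENNReal.ofReal δ • ν) := Measure.smul_finite _ ENNReal.ofReal_ne_top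
  have fabs : ∀ x, |f x| ≤ 1 := fun x => by rw [abs_of_nonneg (hf0 x)]; exact hf1 x
  have fint : ∀ (ρ : Measure X) [IsFiniteMeasure ρ], Integrable f ρ :=
    fun ρ _ => bdd ρ f 1 hf fabs
  have f2int : Integrable (fun x => f x ^ 2) ν := bdd ν _ 1 (hf.pow_const 2) fun x => by
    rw [abs_pow]; exact pow_le_one₀ (abs_nonneg _) (fabs x)
  set m := ∫ x, f x ∂ν with hm
  have hm0 : 0 ≤ m := integral_nonneg hf0
  have hm1 : m ≤ 1 := by
    have := integral_mono (fint ν) (integrable_const (1 : ℝ)) hf1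
    simpa using this
  set g : X → ℝ := fun x => f x - m with hg
  have gmeas : Measurable g := hf.sub_const m
  have gabs : ∀ x, |g x| ≤ 1 := fun x => by
    rw [abs_le]; constructor <;> simp only [hg] <;> linarith [hf0 x, hf1 x]
  have ptail : ∀ (u : X → ℝ), Measurable u → (∀ x, |u x| ≤ 1) →
      ∀ (ρ : Measure X) [IsFiniteMeasure ρ], Integrable (fun x => max (u x) 0) ρ :=
    fun u hu hu1 ρ _ => bdd ρ _ 1 (hu.max measurable_const) fun x => by
      rw [abs_of_nonneg (le_max_right _ _)]
      exact max_le ((le_abs_self _).trans (hu1 x)) zero_le_one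
  have expand : ∀ (ρ : Measure X) [IsFiniteMeasure ρ] (u : X → ℝ),
      (∀ (ρ' : Measure X) [IsFiniteMeasure ρ'], Integrable u ρ') →
      ∫ x, u x ∂(ρ + ENNReal.ofReal δ • ν) = ∫ x, u x ∂ρ + δ * ∫ x, u x ∂ν := by
    intro ρ _ u hu
    rw [integral_add_measure (hu ρ) (hu _), integral_smul_measure, ENNReal.toReal_ofReal hδ,
      smul_eq_mul]
  have hp := ptail g gmeas gabs
  have hn := ptail (fun x => -g x) gmeas.neg (fun x => by rw [abs_neg]; exact gabs x)
  -- The setwise bounds apply only to nonnegative functions, so the centred `g` is split: `h₁`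
  -- handles its positive part and `h₂` its negative part.
  have e1 : ∫ x, max (g x) 0 ∂μ ≤ ∫ x, max (g x) 0 ∂ν + δ * ∫ x, max (g x) 0 ∂ν := by
    rw [← expand ν _ hp]
    exact integral_mono_measure h₁ (Filter.Eventually.of_forall fun x => le_max_right _ _) (hp _)
  have e2 : ∫ x, max (-g x) 0 ∂ν ≤ ∫ x, max (-g x) 0 ∂μ + δ * ∫ x, max (-g x) 0 ∂ν := by
    rw [← expand μ _ hn]
    exact integral_mono_measure h₂ (Filter.Eventually.of_forall fun x => le_max_right _ _) (hn _)
  have split : ∀ (ρ : Measure X) [IsFiniteMeasure ρ],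
      ∫ x, g x ∂ρ = ∫ x, max (g x) 0 ∂ρ - ∫ x, max (-g x) 0 ∂ρ := by
    intro ρ _
    rw [← integral_sub (hp ρ) (hn ρ)]
    refine integral_congr_ae (Filter.Eventually.of_forall fun x => ?_)
    rcases le_total (g x) 0 with h | h <;> simp [h]
  have gabsint : Integrable (fun x => |g x|) ν :=
    bdd ν _ 1 gmeas.abs fun x => by rw [abs_abs]; exact gabs x
  have habs : ∫ x, |g x| ∂ν = ∫ x, max (g x) 0 ∂ν + ∫ x, max (-g x) 0 ∂ν := by
    rw [← integral_add (hp ν) (hn ν)]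
    refine integral_congr_ae (Filter.Eventually.of_forall fun x => ?_)
    rcases le_total (g x) 0 with h | h <;> simp [h, abs_of_nonneg, abs_of_nonpos]
  set t := ∫ x, |g x| ∂ν with ht
  have gν : ∫ x, g x ∂ν = 0 := by
    simp only [hg]
    rw [integral_sub (fint ν) (integrable_const _)]
    simp [hm]
  have gμ : ∫ x, g x ∂μ = ∫ x, f x ∂μ - m := by
    simp only [hg]
    rw [integral_sub (fint μ) (integrable_const _)]
    simp
  have upper : ∫ x, f x ∂μ ≤ m + δ * t := by
    have s1 := split μ
    have s2 := split ν
    rw [habs]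
    nlinarith
  -- The mean absolute deviation `t` is at most the standard deviation: expand `∫ (|g| - t)² ≥ 0`.
  have var : m ^ 2 + t ^ 2 ≤ ∫ x, f x ^ 2 ∂ν := by
    have hsq : 0 ≤ ∫ x, (|g x| - t) ^ 2 ∂ν := integral_nonneg fun x => sq_nonneg _
    have heq : ∫ x, (|g x| - t) ^ 2 ∂ν =
        ∫ x, ((f x ^ 2 - (2 * m) * f x) - (2 * t) * |g x|) + (m ^ 2 + t ^ 2) ∂ν := by
      refine integral_congr_ae (Filter.Eventually.of_forall fun x => ?_)
      have := sq_abs (g x)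
      simp only [hg] at this ⊢
      linear_combination this
    have i1 : Integrable (fun x => f x ^ 2 - (2 * m) * f x) ν := f2int.sub ((fint ν).const_mul _)
    have i2 : Integrable (fun x => f x ^ 2 - (2 * m) * f x - (2 * t) * |g x|) ν :=
      i1.sub (gabsint.const_mul _)
    rw [heq, integral_add i2 (integrable_const _), integral_sub i1 (gabsint.const_mul _),
      integral_sub f2int ((fint ν).const_mul _), integral_const_mul, integral_const_mul, ← hm,
      ← ht] at hsq
    simp at hsq
    nlinarith
  have h0 : 0 ≤ ∫ x, f x ∂μ := integral_nonneg hf0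
  calc (∫ x, f x ∂μ) ^ 2 ≤ (m + δ * t) ^ 2 := pow_le_pow_left₀ h0 upper 2
    -- Cauchy–Schwarz for `(1, δ)` and `(m, t)`; this makes the loss quadratic in `δ`.
    _ ≤ (1 + δ ^ 2) * (m ^ 2 + t ^ 2) := by nlinarith [sq_nonneg (t - δ * m)]
    _ ≤ _ := by gcongr

lemma sq_lintegral_le_of_close {X : Type*} [MeasurableSpace X] (μ ν : Measure X)
    [IsProbabilityMeasure μ] [IsProbabilityMeasure ν] {δ : ℝ} (hδ : 0 ≤ δ)
    (h₁ : μ ≤ ν + ENNReal.ofReal δ • ν) (h₂ : ν ≤ μ + ENNReal.ofReal δ • ν)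
    {f : X → ENNReal} (hf : Measurable f) (hf1 : ∀ x, f x ≤ 1) :
    (∫⁻ x, f x ∂μ) ^ 2 ≤ ENNReal.ofReal (1 + δ ^ 2) * ∫⁻ x, f x ^ 2 ∂ν := by
  have ftop : ∀ x, f x ≠ ⊤ := fun x => ((hf1 x).trans_lt ENNReal.one_lt_top).ne
  have key := sq_integral_le_of_close μ ν hδ h₁ h₂ (f := fun x => (f x).toReal) hf.ennreal_toReal
    (fun x => ENNReal.toReal_nonneg) (fun x => by
      have := ENNReal.toReal_mono ENNReal.one_ne_top (hf1 x)
      simpa using this)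
  simp only [← ENNReal.toReal_pow] at key
  rw [integral_toReal hf.aemeasurable (Filter.Eventually.of_forall fun x => (ftop x).lt_top),
    integral_toReal (hf.pow_const 2).aemeasurable
      (Filter.Eventually.of_forall fun x => (ENNReal.pow_ne_top (ftop x)).lt_top)] at key
  have fin1 : ∫⁻ x, f x ∂μ ≠ ⊤ := by
    refine ((lintegral_mono hf1).trans_lt ?_).ne
    simp
  have fin2 : ∫⁻ x, f x ^ 2 ∂ν ≠ ⊤ := by
    refine ((lintegral_mono fun x => pow_le_one₀ zero_le (hf1 x)).trans_lt ?_).ne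
    simp
  rw [← ENNReal.toReal_le_toReal (ENNReal.pow_ne_top fin1)
    (ENNReal.mul_ne_top ENNReal.ofReal_ne_top fin2), ENNReal.toReal_mul, ENNReal.toReal_pow,
    ENNReal.toReal_ofReal (by positivity)]
  exact key

/-! ### Tensorisation along the interactive transcript -/

namespace PrivateEstimator

variable {α : ℝ} {n : ℕ} {Z : Type*} [MeasurableSpace Z]

/-- The law of the `i`-th stored entry given the history `z`, when the data have law `P`. -/
noncomputable def entryLaw (A : PrivateEstimator α n Z) (P : Measure Data) (i : Fin n)
    (z : Fin i → Z) : Measure Z :=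
  P.bind fun x => A.channel i (z, x)

lemma measurable_channel_section (A : PrivateEstimator α n Z) (i : Fin n) (z : Fin i → Z) :
    Measurable fun x : Data => A.channel i (z, x) :=
  (A.channel i).measurable.comp measurable_prodMk_left

instance isProbabilityMeasure_entryLaw (A : PrivateEstimator α n Z) (P : Measure Data)
    [IsProbabilityMeasure P] (i : Fin n) (z : Fin i → Z) :
    IsProbabilityMeasure (A.entryLaw P i z) := by
  have := A.channel_markov i
  constructor
  unfold entryLaw
  rw [Measure.bind_apply MeasurableSet.univ (A.measurable_channel_section i z).aemeasurable]
  simp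

lemma measurable_snoc {i : ℕ} (z : Fin i → Z) :
    Measurable fun w : Z => Fin.snoc (α := fun _ => Z) z w := by
  refine measurable_pi_lambda _ fun k => ?_
  refine Fin.lastCases ?_ (fun j => ?_) k
  · simpa using measurable_id'
  · simp

lemma lintegral_entryLaw (A : PrivateEstimator α n Z) (P : Measure Data) (i : Fin n)
    (z : Fin i → Z) {f : Z → ENNReal} (hf : Measurable f) :
    ∫⁻ w, f w ∂(A.entryLaw P i z) = ∫⁻ x, ∫⁻ w, f w ∂(A.channel i (z, x)) ∂P :=
  Measure.lintegral_bind (A.measurable_channel_section i z).aemeasurable hf.aemeasurable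

lemma lintegral_transcriptLaw_succ (A : PrivateEstimator α n Z) (P : Measure Data)
    [IsProbabilityMeasure P] (i : ℕ) (h : i + 1 ≤ n) {f : (Fin (i + 1) → Z) → ENNReal}
    (hf : Measurable f) :
    ∫⁻ z, f z ∂(A.transcriptLaw P (i + 1) h) =
      ∫⁻ z, ∫⁻ w, f (Fin.snoc (α := fun _ => Z) z w) ∂(A.entryLaw P ⟨i, h⟩ z)
        ∂(A.transcriptLaw P i (Nat.le_of_succ_le h)) := by
  have := A.channel_markov ⟨i, h⟩
  have := A.isProbabilityMeasure_transcriptLaw P i (Nat.le_of_succ_le h)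
  have hm : Measurable fun w : ((Fin i → Z) × Data) × Z =>
      f (Fin.snoc (α := fun _ => Z) w.1.1 w.2) := hf.comp (measurable_append i)
  rw [transcriptLaw, lintegral_map hf (measurable_append i), Measure.lintegral_compProd hm,
    lintegral_prod _ (Measurable.lintegral_kernel_prod_right' hm).aemeasurable]
  refine lintegral_congr fun z => ?_
  exact (A.lintegral_entryLaw P ⟨i, h⟩ z (hf.comp (measurable_snoc z))).symm

/-- Integrate out the last entry, apply induction to the resulting function of the history, then the
one-step bound for each fixed history. General `f` is needed because the integrated function is no
longer an indicator; interaction is harmless because `δ` is uniform in the history. -/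
lemma sq_lintegral_transcriptLaw_le (A : PrivateEstimator α n Z) (P Q : Measure Data)
    [IsProbabilityMeasure P] [IsProbabilityMeasure Q] {δ : ℝ} (hδ : 0 ≤ δ)
    (h₁ : ∀ i z, A.entryLaw P i z ≤ A.entryLaw Q i z + ENNReal.ofReal δ • A.entryLaw Q i z)
    (h₂ : ∀ i z, A.entryLaw Q i z ≤ A.entryLaw P i z + ENNReal.ofReal δ • A.entryLaw Q i z)
    (i : ℕ) (h : i ≤ n) (f : (Fin i → Z) → ENNReal) (hf : Measurable f) (hf1 : ∀ z, f z ≤ 1) :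
    (∫⁻ z, f z ∂(A.transcriptLaw P i h)) ^ 2 ≤
      ENNReal.ofReal (1 + δ ^ 2) ^ i * ∫⁻ z, f z ^ 2 ∂(A.transcriptLaw Q i h) := by
  induction i with
  | zero =>
    simp only [transcriptLaw]
    rw [lintegral_dirac' _ hf, lintegral_dirac' _ (hf.pow_const 2)]
    simp
  | succ i ih =>
    have hi := Nat.le_of_succ_le h
    have meas : ∀ (R : Measure Data) [IsProbabilityMeasure R] (u : (Fin (i + 1) → Z) → ENNReal),
        Measurable u → Measurable fun z : Fin i → Z =>
          ∫⁻ w, u (Fin.snoc (α := fun _ => Z) z w) ∂(A.entryLaw R ⟨i, h⟩ z) := by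
      intro R _ u hu
      have := A.channel_markov ⟨i, h⟩
      have hm : Measurable fun w : ((Fin i → Z) × Data) × Z =>
          u (Fin.snoc (α := fun _ => Z) w.1.1 w.2) := hu.comp (measurable_append i)
      have hm' := (Measurable.lintegral_kernel_prod_right' (κ := A.channel ⟨i, h⟩) hm
        ).lintegral_prod_right' (ν := R)
      convert hm' using 2 with z
      exact A.lintegral_entryLaw R ⟨i, h⟩ z (hu.comp (measurable_snoc z))
    rw [A.lintegral_transcriptLaw_succ P i h hf,
      A.lintegral_transcriptLaw_succ Q i h (hf.pow_const 2)]
    refine (ih hi _ (meas P f hf) fun z => ?_).trans ?_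
    · refine (lintegral_mono fun w => hf1 _).trans ?_
      simp
    · rw [pow_succ _ i, mul_assoc, ← lintegral_const_mul _ (meas Q _ (hf.pow_const 2))]
      gcongr with z
      have hfz : Measurable fun w => f (Fin.snoc (α := fun _ => Z) z w) :=
        hf.comp (measurable_snoc z)
      exact sq_lintegral_le_of_close (A.entryLaw P ⟨i, h⟩ z) (A.entryLaw Q ⟨i, h⟩ z) hδ
        (h₁ ⟨i, h⟩ z) (h₂ ⟨i, h⟩ z) hfz fun w => hf1 (Fin.snoc (α := fun _ => Z) z w)

end PrivateEstimator

/-! ### The two-point design and its prediction error -/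

lemma lintegral_dataLaw_twoPointDesign (p : ℝ) (L : LabelModel) (θ : Vec) {g : Data → ENNReal}
    (hg : Measurable g) :
    ∫⁻ x, g x ∂(dataLaw (twoPointDesign p) L θ) =
      ENNReal.ofReal (1 - p) *
          ∫⁻ y, g (EuclideanSpace.single 0 1, y) ∂(L.law (EuclideanSpace.single 0 1, θ 0)) +
        ENNReal.ofReal p *
          ∫⁻ y, g (EuclideanSpace.single 1 1, y) ∂(L.law (EuclideanSpace.single 1 1, θ 1)) := by
  have := L.markov
  have : IsFiniteMeasure (twoPointDesign p) := by
    unfold twoPointDesign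
    have := fun (q : ℝ) (v : Vec) =>
      Measure.smul_finite (Measure.dirac v) (c := ENNReal.ofReal q) ENNReal.ofReal_ne_top
    infer_instance
  rw [dataLaw, Measure.lintegral_compProd hg, twoPointDesign, lintegral_add_measure,
    lintegral_smul_measure, lintegral_smul_measure, lintegral_dirac, lintegral_dirac]
  simp [withRegression, Kernel.comap_apply, EuclideanSpace.inner_single_left]

lemma isProbabilityMeasure_twoPointDesign {p : ℝ} (hp0 : 0 ≤ p) (hp1 : p ≤ 1) :
    IsProbabilityMeasure (twoPointDesign p) := by
  constructor
  simp only [twoPointDesign, Measure.coe_add, Measure.coe_smul, Pi.add_apply, Pi.smul_apply,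
    measure_univ, smul_eq_mul, mul_one]
  rw [← ENNReal.ofReal_add (by linarith) hp0]
  simp

lemma twoPointDesign_compl_closedBall (p : ℝ) :
    twoPointDesign p (Metric.closedBall 0 1)ᶜ = 0 := by
  simp [twoPointDesign]

lemma predictionError_twoPointDesign {p : ℝ} (hp0 : 0 ≤ p) (hp1 : p ≤ 1) (θ' θ : Vec) :
    predictionError (twoPointDesign p) θ' θ =
      (1 - p) * (θ' 0 - θ 0) ^ 2 + p * (θ' 1 - θ 1) ^ 2 := by
  have hM : ∀ i j, secondMoment (twoPointDesign p) i j =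
      (1 - p) * ((EuclideanSpace.single (0 : Fin 2) (1 : ℝ) : Vec) i *
          (EuclideanSpace.single (0 : Fin 2) (1 : ℝ) : Vec) j) +
        p * ((EuclideanSpace.single (1 : Fin 2) (1 : ℝ) : Vec) i *
          (EuclideanSpace.single (1 : Fin 2) (1 : ℝ) : Vec) j) := by
    intro i j
    simp only [secondMoment, Matrix.of_apply, twoPointDesign]
    rw [integral_add_measure ((integrable_dirac (by simp)).smul_measure ENNReal.ofReal_ne_top)
      ((integrable_dirac (by simp)).smul_measure ENNReal.ofReal_ne_top),
      integral_smul_measure, integral_smul_measure, integral_dirac, integral_dirac,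
      ENNReal.toReal_ofReal hp0, ENNReal.toReal_ofReal (by linarith)]
    simp
  simp only [predictionError, dotProduct, Matrix.mulVec, Fin.sum_univ_two, hM]
  simp
  ring

/-! ### Closeness of the entry laws under privacy -/

/-- Integrating a `ρ`-stable function over two laws of labels preserves the `ρ`-domination. -/
lemma lintegral_label_le {ρ : ENNReal} {g : Data → ENNReal}
    (hρ : ∀ x ∈ dataDomain, ∀ x' ∈ dataDomain, g x ≤ ρ * g x') (L : LabelModel) {φ φ' : Vec}
    {r r' : ℝ} (hφ : ‖φ‖ ≤ 1) (hφ' : ‖φ'‖ ≤ 1) (hr : |r| ≤ 1) (hr' : |r'| ≤ 1)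
    (hg : Measurable g) :
    ∫⁻ y, g (φ, y) ∂(L.law (φ, r)) ≤ ρ * ∫⁻ y, g (φ', y) ∂(L.law (φ', r')) := by
  have := L.markov
  have ae : ∀ (φ : Vec) (r : ℝ), ‖φ‖ ≤ 1 → |r| ≤ 1 →
      ∀ᵐ y ∂(L.law (φ, r)), (φ, y) ∈ dataDomain := by
    intro φ r hφ hr
    have h : ∀ᵐ y ∂(L.law (φ, r)), y ∈ Set.Icc (-1 : ℝ) 1 :=
      mem_ae_iff.2 (L.bounded φ r hφ hr)
    filter_upwards [h] with y hy using ⟨hφ, hy⟩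
  rw [← lintegral_const_mul (f := fun y => g (φ', y)) _ (hg.comp measurable_prodMk_left)]
  have inner : ∀ y, (φ, y) ∈ dataDomain →
      g (φ, y) ≤ ∫⁻ y', ρ * g (φ', y') ∂(L.law (φ', r')) := by
    intro y hy
    calc g (φ, y) = ∫⁻ _, g (φ, y) ∂(L.law (φ', r')) := by simp
      _ ≤ _ := lintegral_mono_ae (by
        filter_upwards [ae φ' r' hφ' hr'] with y' hy' using hρ _ hy _ hy')
  calc _ ≤ ∫⁻ _, (∫⁻ y', ρ * g (φ', y') ∂(L.law (φ', r'))) ∂(L.law (φ, r)) :=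
        lintegral_mono_ae (by filter_upwards [ae φ r hφ hr] with y hy using inner y hy)
    _ = _ := by simp

/-- The probabilities of a set under the entry laws of two parameters on the `e₂`-axis are mixtures
with a common `e₁`-component `a` and components of pairwise ratio at most `exp α`. -/
lemma exists_entryLaw_eq_mixture {α : ℝ} {n : ℕ} {Z : Type*} [MeasurableSpace Z]
    (A : PrivateEstimator α n Z) {p : ℝ} (hp0 : 0 ≤ p) (hp1 : p ≤ 1) (L : LabelModel)
    {θ θ' : Vec} (h0 : θ 0 = 0) (h0' : θ' 0 = 0) (h1 : |θ 1| ≤ 1) (h1' : |θ' 1| ≤ 1)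
    (i : Fin n) (z : Fin i → Z) (S : Set Z) (hS : MeasurableSet S) :
    ∃ a b b' : ℝ, 0 ≤ a ∧ 0 ≤ b ∧ 0 ≤ b' ∧ b ≤ Real.exp α * b' ∧ b' ≤ Real.exp α * b ∧
      b ≤ Real.exp α * a ∧ b' ≤ Real.exp α * a ∧
      A.entryLaw (dataLaw (twoPointDesign p) L θ) i z S = ENNReal.ofReal ((1 - p) * a + p * b) ∧
      A.entryLaw (dataLaw (twoPointDesign p) L θ') i z S =
        ENNReal.ofReal ((1 - p) * a + p * b') := by
  have := A.channel_markov i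
  have := L.markov
  set g : Data → ENNReal := fun x => A.channel i (z, x) S with hgdef
  have hg : Measurable g :=
    (Measure.measurable_coe hS).comp (A.measurable_channel_section i z)
  have gle : ∀ x, g x ≤ 1 := fun x => prob_le_one
  have hρ : ∀ x ∈ dataDomain, ∀ x' ∈ dataDomain, g x ≤ ENNReal.ofReal (Real.exp α) * g x' :=
    fun x hx x' hx' => A.privacy i z x hx x' hx' S hS
  have fin : ∀ (φ : Vec) (r : ℝ), ∫⁻ y, g (φ, y) ∂(L.law (φ, r)) ≠ ⊤ := fun φ r =>
    ((lintegral_mono fun y => gle (φ, y)).trans_lt (by simp)).ne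
  have n1 : ‖(EuclideanSpace.single 0 1 : Vec)‖ ≤ 1 := by simp
  have n2 : ‖(EuclideanSpace.single 1 1 : Vec)‖ ≤ 1 := by simp
  have z1 : |(0 : ℝ)| ≤ 1 := by simp
  have real : ∀ {φ φ' : Vec} {r r' : ℝ}, ‖φ‖ ≤ 1 → ‖φ'‖ ≤ 1 → |r| ≤ 1 → |r'| ≤ 1 →
      (∫⁻ y, g (φ, y) ∂(L.law (φ, r))).toReal ≤
        Real.exp α * (∫⁻ y, g (φ', y) ∂(L.law (φ', r'))).toReal := by
    intro φ φ' r r' hφ hφ' hr hr'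
    have := ENNReal.toReal_mono (ENNReal.mul_ne_top ENNReal.ofReal_ne_top (fin φ' r'))
      (lintegral_label_le hρ L hφ hφ' hr hr' hg)
    rwa [ENNReal.toReal_mul, ENNReal.toReal_ofReal (Real.exp_pos α).le] at this
  have law : ∀ θ : Vec, A.entryLaw (dataLaw (twoPointDesign p) L θ) i z S =
      ENNReal.ofReal ((1 - p) *
          (∫⁻ y, g (EuclideanSpace.single 0 1, y)
            ∂(L.law (EuclideanSpace.single 0 1, θ 0))).toReal +
        p * (∫⁻ y, g (EuclideanSpace.single 1 1, y)
            ∂(L.law (EuclideanSpace.single 1 1, θ 1))).toReal) := by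
    intro θ
    have hp1' : 0 ≤ 1 - p := by linarith
    rw [PrivateEstimator.entryLaw, Measure.bind_apply hS
      (A.measurable_channel_section i z).aemeasurable, lintegral_dataLaw_twoPointDesign p L θ hg,
      ENNReal.ofReal_add (by positivity) (by positivity), ENNReal.ofReal_mul hp1',
      ENNReal.ofReal_mul hp0, ENNReal.ofReal_toReal (fin _ _), ENNReal.ofReal_toReal (fin _ _)]
  -- The witnesses are the channel probability of `S` averaged over the label laws at `(e₁, 0)`,
  -- `(e₂, θ 1)` and `(e₂, θ' 1)`.
  refine ⟨_, _, _, ENNReal.toReal_nonneg, ENNReal.toReal_nonneg, ENNReal.toReal_nonneg,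
    real n2 n2 h1 h1', real n2 n2 h1' h1, real n2 n1 h1 z1, real n2 n1 h1' z1, ?_, ?_⟩
  · rw [law θ, h0]
  · rw [law θ', h0']

/-- The common `e₁`-parts cancel, leaving `p (b - b')`, where `b - b' ≤ (exp α - 1) b'`. The extra
`exp α` comes from bounding `b'` by the whole mixture, so that `p` survives as a factor. Both errors
are relative to the law under `θ'`, as the χ² bound requires. -/
lemma entryLaw_le {α : ℝ} {n : ℕ} {Z : Type*} [MeasurableSpace Z] (hα : 0 ≤ α)
    (A : PrivateEstimator α n Z) {p : ℝ} (hp0 : 0 ≤ p) (hp1 : p ≤ 1) (L : LabelModel)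
    {θ θ' : Vec} (h0 : θ 0 = 0) (h0' : θ' 0 = 0) (h1 : |θ 1| ≤ 1) (h1' : |θ' 1| ≤ 1)
    (i : Fin n) (z : Fin i → Z) :
    A.entryLaw (dataLaw (twoPointDesign p) L θ) i z ≤
        A.entryLaw (dataLaw (twoPointDesign p) L θ') i z +
          ENNReal.ofReal (p * (Real.exp α - 1) * Real.exp α) •
            A.entryLaw (dataLaw (twoPointDesign p) L θ') i z ∧
      A.entryLaw (dataLaw (twoPointDesign p) L θ') i z ≤
        A.entryLaw (dataLaw (twoPointDesign p) L θ) i z +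
          ENNReal.ofReal (p * (Real.exp α - 1) * Real.exp α) •
            A.entryLaw (dataLaw (twoPointDesign p) L θ') i z := by
  have hE : 1 ≤ Real.exp α := Real.one_le_exp hα
  set E := Real.exp α with hEdef
  have hE0 : 0 ≤ E - 1 := by linarith
  have hq : 0 ≤ 1 - p := by linarith
  have hδ : 0 ≤ p * (E - 1) * E := by positivity
  -- Here `c` is the `e₂`-component of the reference mixture; it stays that of `θ'` when `b` and
  -- `b'` are swapped for the second inequality.
  have main : ∀ {a b b' c : ℝ}, b ≤ E * b' → b' ≤ E * a → b' ≤ E * c →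
      p * (b - b') ≤ p * (E - 1) * E * ((1 - p) * a + p * c) := by
    intro a b b' c h₁ h₂ h₃
    have s1 : b' ≤ E * ((1 - p) * a + p * c) := by nlinarith
    calc p * (b - b') ≤ p * ((E - 1) * b') := by gcongr; linarith
      _ = p * (E - 1) * b' := by ring
      _ ≤ p * (E - 1) * (E * ((1 - p) * a + p * c)) := by gcongr
      _ = _ := by ring
  constructor <;>
  · refine Measure.le_iff.2 fun S hS => ?_
    obtain ⟨a, b, b', ha, hb, hb', h₁, h₂, h₃, h₄, e, e'⟩ :=
      exists_entryLaw_eq_mixture A hp0 hp1 L h0 h0' h1 h1' i z S hS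
    rw [Measure.add_apply, Measure.smul_apply, e, e', smul_eq_mul, ← ENNReal.ofReal_mul hδ,
      ← ENNReal.ofReal_add (by positivity) (by positivity)]
    refine ENNReal.ofReal_le_ofReal ?_
    have m1 := main h₁ h₄ (show b' ≤ E * b' by nlinarith)
    have m2 := main h₂ h₃ h₁
    linarith

/-! ### Two-point testing argument -/

/-- The prediction error under the two-point design dominates `p` on estimates whose `e₂`-coordinate
has the wrong sign. -/
lemma mul_measure_le_meanSquareError {α : ℝ} {n : ℕ} {Z : Type*} [MeasurableSpace Z] {p : ℝ}
    (hp0 : 0 ≤ p) (hp1 : p ≤ 1) (L : LabelModel) (A : PrivateEstimator α n Z) (θ : Vec)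
    {S : Set Vec} (hS : MeasurableSet S) (h : ∀ v ∈ S, 1 ≤ (v 1 - θ 1) ^ 2) :
    ENNReal.ofReal p * A.estimateLaw (dataLaw (twoPointDesign p) L θ) S ≤
      meanSquareError (twoPointDesign p) L A θ := by
  unfold meanSquareError
  rw [← setLIntegral_const]
  refine (setLIntegral_mono' hS fun v hv => ?_).trans (setLIntegral_le_lintegral S _)
  refine ENNReal.ofReal_le_ofReal ?_
  rw [predictionError_twoPointDesign hp0 hp1]
  nlinarith [h v hv, mul_nonneg (sub_nonneg.2 hp1) (sq_nonneg (v 0 - θ 0))]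

/-- Two-point lower bound for privately estimating the sign of the rarely seen coordinate. -/
lemma le_iSup_meanSquareError {α : ℝ} {n : ℕ} {Z : Type*} [MeasurableSpace Z] (hα : 0 ≤ α)
    {p : ℝ} (hp0 : 0 ≤ p) (hp1 : p ≤ 1)
    (hn : (n : ℝ) * (p * (Real.exp α - 1) * Real.exp α) ^ 2 ≤ 1 / 2)
    (L : LabelModel) (A : PrivateEstimator α n Z) :
    ENNReal.ofReal (p / 4) ≤
      ⨆ θ ∈ ({EuclideanSpace.single 1 1, EuclideanSpace.single 1 (-1)} : Set Vec),
        meanSquareError (twoPointDesign p) L A θ := by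
  have := isProbabilityMeasure_twoPointDesign hp0 hp1
  have := A.output_markov
  set θ₁ : Vec := EuclideanSpace.single 1 1 with hθ₁
  set θ₂ : Vec := EuclideanSpace.single 1 (-1) with hθ₂
  set P := dataLaw (twoPointDesign p) L θ₁ with hP
  set Q := dataLaw (twoPointDesign p) L θ₂ with hQ
  set δ := p * (Real.exp α - 1) * Real.exp α with hδdef
  have hE : 0 ≤ Real.exp α - 1 := by linarith [Real.one_le_exp hα]
  have hδ : 0 ≤ δ := by positivity
  have close := entryLaw_le hα A hp0 hp1 L (θ := θ₁) (θ' := θ₂) (by simp [hθ₁]) (by simp [hθ₂])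
    (by simp [hθ₁]) (by simp [hθ₂])
  set S : Set Vec := {v | 0 < v 1} with hSdef
  have hS : MeasurableSet S := measurableSet_lt measurable_const (by fun_prop)
  have hTP := A.isProbabilityMeasure_transcriptLaw P n le_rfl
  have hTQ := A.isProbabilityMeasure_transcriptLaw Q n le_rfl
  have hfm : Measurable fun z => A.output z S := A.output.measurable_coe hS
  have estP : A.estimateLaw P S = ∫⁻ z, A.output z S ∂(A.transcriptLaw P n le_rfl) :=
    Measure.bind_apply hS A.output.measurable.aemeasurable
  have estQ : A.estimateLaw Q S = ∫⁻ z, A.output z S ∂(A.transcriptLaw Q n le_rfl) :=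
    Measure.bind_apply hS A.output.measurable.aemeasurable
  have probP : IsProbabilityMeasure (A.estimateLaw P) := by
    constructor
    rw [PrivateEstimator.estimateLaw,
      Measure.bind_apply MeasurableSet.univ A.output.measurable.aemeasurable]
    simp
  have hB : (1 + δ ^ 2) ^ n ≤ 2 := by
    calc (1 + δ ^ 2) ^ n ≤ Real.exp (δ ^ 2) ^ n := by
          gcongr; linarith [Real.add_one_le_exp (δ ^ 2)]
      _ = Real.exp (n * δ ^ 2) := (Real.exp_nat_mul _ _).symm
      _ ≤ Real.exp (Real.log 2) := Real.exp_le_exp.2 (by linarith [Real.log_two_gt_d9])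
      _ = 2 := Real.exp_log two_pos
  have key : A.estimateLaw P S ^ 2 ≤ 2 * A.estimateLaw Q S := by
    rw [estP, estQ]
    refine (A.sq_lintegral_transcriptLaw_le P Q hδ (fun i z => (close i z).1)
      (fun i z => (close i z).2) n le_rfl _ hfm fun z => prob_le_one).trans ?_
    gcongr with z
    · rw [← ENNReal.ofReal_pow (by positivity)]
      exact (ENNReal.ofReal_le_ofReal hB).trans (by simp)
    · exact pow_le_of_le_one zero_le prob_le_one two_ne_zero
  have quarter : ENNReal.ofReal (p / 4) = ENNReal.ofReal p * ENNReal.ofReal (1 / 4) := by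
    rw [← ENNReal.ofReal_mul hp0]; congr 1; ring
  rw [quarter]
  -- Either the sign is wrong under `θ₁` with probability at least `1/4`, or `key` gives
  -- `Q`-probability at least `(3/4)² / 2 = 9/32 > 1/4` of a wrong sign under `θ₂`.
  rcases le_total (A.estimateLaw P S) (ENNReal.ofReal (3 / 4)) with hx | hx
  · refine le_trans ?_ (le_iSup₂ (f := fun θ _ => meanSquareError (twoPointDesign p) L A θ) θ₁
      (Set.mem_insert _ _))
    refine le_trans ?_ (mul_measure_le_meanSquareError hp0 hp1 L A θ₁ hS.compl fun v hv => ?_)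
    · gcongr
      rw [prob_compl_eq_one_sub hS]
      calc ENNReal.ofReal (1 / 4) = 1 - ENNReal.ofReal (3 / 4) := by
            rw [← ENNReal.ofReal_one, ← ENNReal.ofReal_sub _ (by norm_num)]; norm_num
        _ ≤ _ := tsub_le_tsub_left hx 1
    · have : v 1 ≤ 0 := not_lt.1 hv
      simp only [hθ₁, PiLp.single_apply, if_true]
      nlinarith
  · refine le_trans ?_ (le_iSup₂ (f := fun θ _ => meanSquareError (twoPointDesign p) L A θ) θ₂
      (Set.mem_insert_of_mem _ rfl))
    refine le_trans ?_ (mul_measure_le_meanSquareError hp0 hp1 L A θ₂ hS fun v hv => ?_)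
    · gcongr
      have h2 : 2 * ENNReal.ofReal (1 / 4) ≤ 2 * A.estimateLaw Q S := by
        refine le_trans ?_ ((pow_le_pow_left₀ zero_le hx 2).trans key)
        rw [← ENNReal.ofReal_pow (by norm_num), ← ENNReal.ofReal_ofNat 2,
          ← ENNReal.ofReal_mul (by norm_num)]
        exact ENNReal.ofReal_le_ofReal (by norm_num)
      exact (ENNReal.mul_le_mul_iff_right two_ne_zero ENNReal.ofNat_ne_top).1 h2
    · have : 0 < v 1 := hv
      simp only [hθ₂, PiLp.single_apply, if_true]
      nlinarith

end LDPRegression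

/-! ### Choice of constants -/

theorem mainTheorem3 :
    ∃ C > (0 : ℝ), ∃ c ∈ Set.Ioc (0 : ℝ) 1, ∀ α ∈ Set.Ioc (0 : ℝ) 1, ∃ Cα > (0 : ℝ),
      ∀ n : ℕ, 1 ≤ n →
        ∃ (D : Measure LDPRegression.Vec) (Θ : Set LDPRegression.Vec),
          IsProbabilityMeasure D ∧
          D (Metric.closedBall 0 1)ᶜ = 0 ∧
          D = LDPRegression.twoPointDesign
            (c * min 1 (1 / ((Real.exp α - 1) * Real.sqrt n))) ∧
          Θ ⊆ Metric.closedBall 0 1 ∧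
          ∀ (L : LDPRegression.LabelModel) (Z : Type*) [MeasurableSpace Z]
            (A : LDPRegression.PrivateEstimator α n Z),
            ENNReal.ofReal (C * min 1 (1 / ((Real.exp α - 1) * Real.sqrt n))) ≤
                ⨆ θ ∈ Θ, LDPRegression.meanSquareError D L A θ ∧
            ENNReal.ofReal (Cα / ((Real.exp α - 1) * Real.sqrt n)) ≤
                ⨆ θ ∈ Θ, LDPRegression.meanSquareError D L A θ := by
  -- With `c = 1/5` and `exp α ≤ 3`, `n δ² ≤ 9/25 ≤ 1/2`; then `C = c / 4`.
  refine ⟨1 / 20, by norm_num, 1 / 5, ⟨by norm_num, by norm_num⟩, fun α hα => ?_⟩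
  have hE : 0 < Real.exp α - 1 := by linarith [Real.add_one_lt_exp hα.1.ne', hα.1]
  have hE3 : Real.exp α ≤ 3 := by
    linarith [Real.exp_le_exp.2 hα.2, Real.exp_one_lt_d9]
  -- Since `x (exp α - 1) = 1/√n ≤ 1` and `exp α - 1 ≤ 2`, half of `x (exp α - 1)` is below `min 1
  -- x`; multiplying by `C = 1/20` gives the `40`.
  refine ⟨(Real.exp α - 1) / 40, by positivity, fun n hn => ?_⟩
  have hn1 : 1 ≤ Real.sqrt n := Real.one_le_sqrt.2 (by exact_mod_cast hn)
  set s := Real.sqrt n with hs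
  set x := 1 / ((Real.exp α - 1) * s) with hx
  set q := min 1 x with hq
  have hs0 : 0 < s := by linarith
  have hx0 : 0 < x := by positivity
  have hxs : x * (Real.exp α - 1) * s = 1 := by rw [hx]; field_simp
  have hxE : x * (Real.exp α - 1) ≤ 1 := by
    nlinarith [mul_pos hx0 hE]
  have hq0 : 0 ≤ q := le_min zero_le_one hx0.le
  have hq1 : q ≤ 1 := min_le_left _ _
  have hqs : q * (Real.exp α - 1) * s ≤ 1 := by
    refine le_trans ?_ hxs.le
    gcongr
    exact min_le_right _ _
  have hqx : x * (Real.exp α - 1) / 2 ≤ q := le_min (by linarith) (by nlinarith)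
  have hp0 : 0 ≤ 1 / 5 * q := by positivity
  have hp1 : 1 / 5 * q ≤ 1 := by linarith
  refine ⟨LDPRegression.twoPointDesign (1 / 5 * q),
    {EuclideanSpace.single 1 1, EuclideanSpace.single 1 (-1)},
    LDPRegression.isProbabilityMeasure_twoPointDesign hp0 hp1,
    LDPRegression.twoPointDesign_compl_closedBall _, rfl, ?_, fun L Z _ A => ?_⟩
  · rintro v (rfl | rfl) <;> simp
  · have bound := LDPRegression.le_iSup_meanSquareError hα.1.le hp0 hp1 (by
      have h1 : (q * (Real.exp α - 1) * s) ^ 2 ≤ 1 := pow_le_one₀ (by positivity) hqs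
      have h2 : Real.exp α ^ 2 ≤ 9 := by nlinarith [Real.exp_pos α]
      have hsn : s ^ 2 = n := Real.sq_sqrt (Nat.cast_nonneg n)
      rw [← hsn]
      calc s ^ 2 * (1 / 5 * q * (Real.exp α - 1) * Real.exp α) ^ 2
          = 1 / 25 * ((q * (Real.exp α - 1) * s) ^ 2 * Real.exp α ^ 2) := by ring
        _ ≤ 1 / 25 * (1 * 9) := by gcongr
        _ ≤ 1 / 2 := by norm_num) L A
    constructor
    · exact (ENNReal.ofReal_le_ofReal (by linarith)).trans bound
    · refine (ENNReal.ofReal_le_ofReal ?_).trans bound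
      have : (Real.exp α - 1) / 40 / ((Real.exp α - 1) * s) = x * (Real.exp α - 1) / 40 := by
        rw [hx]; ring
      rw [this]
      linarith
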